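/- Let $\mathbb{D}=\{z\in\mathbb{C}:|z|<1\}$, $b\in\mathbb{C}$ and $z_0\in\mathbb{D}\setminus\{0\}$. Let $\Omega\subsetneq\mathbb{C}$ be a domain that is starlike with respect to $b$, that is, $b\in\Omega$ and the segment $[b,w]$ lies in $\Omega$ for every $w\in\Omega$. Let $P$ be a conformal map (analytic bijection) of $\mathbb{D}$ onto $\Omega$ with $P(0)=b$, and let $\mathcal{F}_\Omega$ be the class of analytic functions $g$ in $\mathbb{D}$ with $g(\mathbb{D})\subset\Omega$. Put $$K(z)=\int_0^z\frac{P(\zeta)-b}{\zeta}\,d\zeta\quad(z\in\mathbb{D}),\qquad V=\left\{\int_0^{z_0}\frac{g(\zeta)-b}{\zeta}\,d\zeta:\ g\in\mathcal{F}_\Omega,\ g(0)=b\right\}.$$ Then $V$ is a convex closed Jordan domain (that is, $V$ is convex and is the closure of a bounded domain whose boundary is a Jordan curve), and $$V=K(\{z\in\mathbb{C}:|z|\le|z_0|\}).$$ Furthermore, for every $\varepsilon\in\mathbb{C}$ with $|\varepsilon|=1$ and every $g\in\mathcal{F}_\Omega$ with $g(0)=b$, the relation $$\int_0^{z_0}\frac{g(\zeta)-b}{\zeta}\,d\zeta=K(\varepsilon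 z_0)$$ holds if and only if $g(z)=P(\varepsilon z)$ for all $z\in\mathbb{D}$. -/

import Mathlib

/-- The complex line integral of `f` along the straight segment from `0` to `z`,
parametrized by `ζ = t z`, `0 ≤ t ≤ 1`. The value of `f` at `0` is irrelevant. -/
noncomputable def segmentIntegral (f : ℂ → ℂ) (z : ℂ) : ℂ :=
  ∫ t in (0 : ℝ)..1, f ((t : ℂ) * z) * z

/-- The integral of `(g ζ - b) / ζ` from `0` to `z`. For `g` analytic in the unit disk with
`g 0 = b` the integrand has a removable singularity at `0`. -/
noncomputable def diffQuotIntegral (b : ℂ) (g : ℂ → ℂ) (z : ℂ) : ℂ :=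
  segmentIntegral (fun ζ => (g ζ - b) / ζ) z

/-- The functions that are analytic in the unit disk and map it into `Ω`
(values outside the disk play no role). -/
def analyticInto (Ω : Set ℂ) : Set (ℂ → ℂ) :=
  {g | DifferentiableOn ℂ g (Metric.ball 0 1) ∧ Set.MapsTo g (Metric.ball 0 1) Ω}

/-- `P` is a conformal map (analytic bijection) of the unit disk onto `Ω`. -/
def IsConformalMapOfDiskOnto (P : ℂ → ℂ) (Ω : Set ℂ) : Prop :=
  DifferentiableOn ℂ P (Metric.ball 0 1) ∧ Set.BijOn P (Metric.ball 0 1) Ω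

/-- The region of variability of the integral of `(g ζ - b) / ζ` from `0` to `z₀`, where `g`
ranges over the analytic functions from the unit disk into `Ω` with `g 0 = b`. -/
def variabilityRegion (Ω : Set ℂ) (b z₀ : ℂ) : Set ℂ :=
  {w | ∃ g ∈ analyticInto Ω, g 0 = b ∧ diffQuotIntegral b g z₀ = w}

/-- A Jordan curve: an injective continuous image of the unit circle. -/
def IsJordanCurve (J : Set ℂ) : Prop :=
  ∃ γ : Circle → ℂ, Continuous γ ∧ Function.Injective γ ∧ Set.range γ = J

/-- A Jordan domain: a bounded domain whose boundary is a Jordan curve. -/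
def IsJordanDomain (U : Set ℂ) : Prop :=
  IsOpen U ∧ IsConnected U ∧ Bornology.IsBounded U ∧ IsJordanCurve (frontier U)

/-- A closed Jordan domain: the closure of a Jordan domain. -/
def IsClosedJordanDomain (S : Set ℂ) : Prop :=
  ∃ U : Set ℂ, IsJordanDomain U ∧ S = closure U

/-! Since z K'(z) = P(z) - b, the outer normal to the curve K(|z| = r) at K(w) is P(w) - b. By the
Schwarz lemma for P⁻¹(b + t(P - b)), starlikeness of Ω means that |P⁻¹| increases strictly along
each ray from b (`norm_le_of_sub_eq_mul_sub`). So distinct points of |z| = r have distinct normal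
directions, and for w ≠ 0 the functional Re(conj(P(w) - b) K) is maximal on |z| ≤ |w| only at w
(`re_le_and_eq_of_re_eq`). Injectivity of K and convexity of the images of disks follow.

For g in the class, let G be its integral and ω = K⁻¹ ∘ G. Where |ω(z)/z| is maximal on a closed
disk about 0, Jack's lemma gives z ω' = m ω with m ≥ 1 (if ω ≠ 0 there), so g - b = m (P ∘ ω - b).
As g is subordinate to P, starlikeness yields |ω(z)| ≤ |z| (`norm_invFunOn_le`). A continuity
argument in the radius shows that ω exists on the whole disk (`mapsTo_diffQuotIntegral`). Hence V
lies in K(|z| ≤ |z₀|); the functions P(cz) with |c| ≤ 1 fill this set, and equality in the Schwarz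
lemma for ω gives the uniqueness statement. -/

open Metric Set Filter Topology
open scoped ComplexConjugate

/-! ### Inverses of injective holomorphic functions -/

/-- An injective holomorphic function on a connected open set is an open map. -/
theorem isOpen_image_of_injOn {f : ℂ → ℂ} {U : Set ℂ} (hU : IsOpen U) (hc : IsPreconnected U)
    (hf : DifferentiableOn ℂ f U) (hi : InjOn f U) {s : Set ℂ} (hs : s ⊆ U) (hso : IsOpen s) :
    IsOpen (f '' s) := by
  rcases (hf.analyticOnNhd hU).is_constant_or_isOpen hc with ⟨w, hw⟩ | h
  · have hsub : s.Subsingleton := fun x hx y hy =>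
      hi (hs hx) (hs hy) ((hw x (hs hx)).trans (hw y (hs hy)).symm)
    rcases s.eq_empty_or_nonempty with rfl | ⟨x, hx⟩
    · simp
    · have hs' : s = {x} := hsub.eq_singleton_of_mem hx
      exact absurd (hs' ▸ hso) (not_isOpen_singleton x)
  · exact h s hs hso

theorem continuousAt_invFunOn {f : ℂ → ℂ} {U : Set ℂ} (hU : IsOpen U) (hc : IsPreconnected U)
    (hf : DifferentiableOn ℂ f U) (hi : InjOn f U) {z : ℂ} (hz : z ∈ U) :
    ContinuousAt (Function.invFunOn f U) (f z) := by
  have hz' : Function.invFunOn f U (f z) = z := hi.leftInvOn_invFunOn hz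
  intro V hV
  rw [hz'] at hV
  obtain ⟨W, hWV, hWo, hzW⟩ := _root_.mem_nhds_iff.1 (inter_mem hV (hU.mem_nhds hz))
  have h1 : f '' W ∈ 𝓝 (f z) :=
    (isOpen_image_of_injOn hU hc hf hi (fun x hx => (hWV hx).2) hWo).mem_nhds ⟨z, hzW, rfl⟩
  rw [mem_map]
  filter_upwards [h1]
  rintro _ ⟨x, hx, rfl⟩
  change Function.invFunOn f U (f x) ∈ V
  rw [hi.leftInvOn_invFunOn (hWV hx).2]
  exact (hWV hx).1

theorem differentiableAt_invFunOn_of_deriv_ne_zero {f : ℂ → ℂ} {U : Set ℂ} (hU : IsOpen U)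
    (hf : DifferentiableOn ℂ f U) (hi : InjOn f U)
    {z : ℂ} (hz : z ∈ U) (hd : deriv f z ≠ 0) :
    DifferentiableAt ℂ (Function.invFunOn f U) (f z) := by
  have hst := ((hf.analyticOnNhd hU) z hz).hasStrictDerivAt
  refine (hst.to_local_left_inverse hd ?_).hasDerivAt.differentiableAt
  filter_upwards [hU.mem_nhds hz] with x hx
  exact hi.leftInvOn_invFunOn hx

/-- Zeros of f' are isolated, since otherwise f would be constant on a ball. The inverse is thus
holomorphic on a punctured neighbourhood of f(z) and continuous at f(z), so the singularity is
removable. -/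
theorem differentiableAt_invFunOn {f : ℂ → ℂ} {U : Set ℂ} (hU : IsOpen U) (hc : IsPreconnected U)
    (hf : DifferentiableOn ℂ f U) (hi : InjOn f U) {z : ℂ} (hz : z ∈ U) :
    DifferentiableAt ℂ (Function.invFunOn f U) (f z) := by
  have hcont := continuousAt_invFunOn hU hc hf hi hz
  have hfa := (hf.analyticOnNhd hU) z hz
  rcases hfa.deriv.eventually_eq_zero_or_eventually_ne_zero with h0 | h0
  · exfalso
    obtain ⟨ε, hε, hball⟩ := Metric.mem_nhds_iff.1 (inter_mem h0 (hU.mem_nhds hz))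
    have hconst : ∀ x ∈ ball z ε, f x = f z := fun x hx =>
      isOpen_ball.is_const_of_deriv_eq_zero (convex_ball z ε).isPreconnected
        (hf.mono fun y hy => (hball hy).2) (fun y hy => (hball hy).1) hx (mem_ball_self hε)
    have hx : z + (ε / 2 : ℝ) ∈ ball z ε := by
      simp [abs_of_pos hε, show 0 < ε from hε]
    have := hi (hball hx).2 hz (hconst _ hx)
    simp [hε.ne'] at this
  · refine (Complex.analyticAt_of_differentiable_on_punctured_nhds_of_continuousAt ?_
      hcont).differentiableAt
    rw [eventually_nhdsWithin_iff] at h0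
    obtain ⟨W, hWV, hWo, hzW⟩ := _root_.mem_nhds_iff.1 (inter_mem h0 (hU.mem_nhds hz))
    have h1 : f '' W ∈ 𝓝 (f z) :=
      (isOpen_image_of_injOn hU hc hf hi (fun x hx => (hWV hx).2) hWo).mem_nhds ⟨z, hzW, rfl⟩
    rw [eventually_nhdsWithin_iff]
    filter_upwards [h1]
    rintro _ ⟨x, hx, rfl⟩ hne
    exact differentiableAt_invFunOn_of_deriv_ne_zero hU hf hi (hWV hx).2
      ((hWV hx).1 fun h : x = z => hne (by rw [h]; rfl))

theorem differentiableOn_invFunOn {f : ℂ → ℂ} {U : Set ℂ} (hU : IsOpen U) (hc : IsPreconnected U)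
    (hf : DifferentiableOn ℂ f U) (hi : InjOn f U) :
    DifferentiableOn ℂ (Function.invFunOn f U) (f '' U) := by
  rintro _ ⟨z, hz, rfl⟩
  exact (differentiableAt_invFunOn hU hc hf hi hz).differentiableWithinAt

theorem deriv_ne_zero_of_injOn {f : ℂ → ℂ} {U : Set ℂ} (hU : IsOpen U) (hc : IsPreconnected U)
    (hf : DifferentiableOn ℂ f U) (hi : InjOn f U) {z : ℂ} (hz : z ∈ U) : deriv f z ≠ 0 := by
  intro h0
  have h1 : HasDerivAt (Function.invFunOn f U ∘ f)
      (deriv (Function.invFunOn f U) (f z) * deriv f z) z :=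
    (differentiableAt_invFunOn hU hc hf hi hz).hasDerivAt.comp z
      (hf.differentiableAt (hU.mem_nhds hz)).hasDerivAt
  have h2 : HasDerivAt (Function.invFunOn f U ∘ f) 1 z :=
    (hasDerivAt_id z).congr_of_eventuallyEq <| by
      filter_upwards [hU.mem_nhds hz] with x hx
      exact hi.leftInvOn_invFunOn hx
  have := h1.unique h2
  simp [h0] at this

/-! ### The integral as a primitive of the difference quotient -/

/-- Here q is the continuous extension of f. The point t = 0 is left out of `hfq` because (g ζ - b)
/ ζ takes the default value 0 there. -/
theorem segmentIntegral_eq_sub {f q F : ℂ → ℂ} {z : ℂ} (hz : z ∈ ball (0 : ℂ) 1)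
    (hq : ContinuousOn q (ball 0 1))
    (hF : ∀ x ∈ ball (0 : ℂ) 1, HasDerivAt F (q x) x)
    (hfq : ∀ t ∈ Ioc (0 : ℝ) 1, f (t * z) * z = q (t * z) * z) :
    segmentIntegral f z = F z - F 0 := by
  have hmem : ∀ t ∈ Icc (0 : ℝ) 1, (t : ℂ) * z ∈ ball (0 : ℂ) 1 := by
    intro t ht
    rw [mem_ball_zero_iff] at hz ⊢
    rw [norm_mul, Complex.norm_real, Real.norm_of_nonneg ht.1]
    nlinarith [ht.1, ht.2, norm_nonneg z]
  have h1 : segmentIntegral f z = ∫ t in (0 : ℝ)..1, q (t * z) * z := by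
    refine intervalIntegral.integral_congr_ae (Eventually.of_forall fun t ht => ?_)
    rw [uIoc_of_le zero_le_one] at ht
    exact hfq t ht
  rw [h1, intervalIntegral.integral_eq_sub_of_hasDerivAt (f := fun t : ℝ => F (t * z))]
  · simp
  · intro t ht
    rw [uIcc_of_le zero_le_one] at ht
    have h2 : HasDerivAt (fun t : ℝ => (t : ℂ) * z) z t := by
      simpa using (Complex.ofRealCLM.hasDerivAt (x := t)).mul_const z
    exact (hF _ (hmem t ht)).comp t h2
  · apply ContinuousOn.intervalIntegrable
    rw [uIcc_of_le zero_le_one]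
    exact (hq.comp (by fun_prop) hmem).mul continuousOn_const

theorem diffQuotIntegral_zero (b : ℂ) (g : ℂ → ℂ) : diffQuotIntegral b g 0 = 0 := by
  simp [diffQuotIntegral, segmentIntegral]

theorem diffQuotIntegral_comp_mul {b : ℂ} {g : ℂ → ℂ} (hg0 : g 0 = b) (c z : ℂ) :
    diffQuotIntegral b (fun ζ => g (c * ζ)) z = diffQuotIntegral b g (c * z) := by
  unfold diffQuotIntegral segmentIntegral
  refine intervalIntegral.integral_congr fun t _ => ?_
  simp only
  rw [mul_left_comm c]
  rcases eq_or_ne c 0 with rfl | hc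
  · simp [hg0]
  rcases eq_or_ne z 0 with rfl | hz
  · simp
  rcases eq_or_ne t 0 with rfl | ht
  · simp
  have : (t : ℂ) ≠ 0 := by exact_mod_cast ht
  field_simp

theorem differentiableOn_dslope_zero {g : ℂ → ℂ} (hg : DifferentiableOn ℂ g (ball 0 1)) :
    DifferentiableOn ℂ (dslope g 0) (ball 0 1) :=
  (Complex.differentiableOn_dslope (ball_mem_nhds 0 one_pos)).2 hg

theorem hasDerivAt_diffQuotIntegral {b : ℂ} {g : ℂ → ℂ} (hg : DifferentiableOn ℂ g (ball 0 1))
    (hg0 : g 0 = b) {z : ℂ} (hz : z ∈ ball (0 : ℂ) 1) :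
    HasDerivAt (diffQuotIntegral b g) (dslope g 0 z) z := by
  have hq := differentiableOn_dslope_zero hg
  obtain ⟨F, hF⟩ := hq.isExactOn_ball
  have : ∀ x ∈ ball (0 : ℂ) 1, diffQuotIntegral b g x = F x - F 0 := by
    intro x hx
    refine segmentIntegral_eq_sub hx hq.continuousOn hF fun t ht => ?_
    rcases eq_or_ne x 0 with rfl | hx0
    · simp
    · have : (t : ℂ) ≠ 0 := by exact_mod_cast ht.1.ne'
      rw [dslope_of_ne _ (mul_ne_zero this hx0), slope_def_field, hg0, sub_zero]
  refine ((hF z hz).sub_const (F 0)).congr_of_eventuallyEq ?_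
  filter_upwards [isOpen_ball.mem_nhds hz] with x hx using this x hx

theorem mul_dslope_zero (g : ℂ → ℂ) (z : ℂ) : z * dslope g 0 z = g z - g 0 := by
  simpa using sub_smul_dslope g 0 z

/-! ### Schwarz equality and first-order conditions at a maximum -/

/-- Equality case of the Schwarz lemma. -/
theorem exists_eq_mul_of_norm_eq {φ : ℂ → ℂ} (hφ : DifferentiableOn ℂ φ (ball 0 1))
    (hm : MapsTo φ (ball 0 1) (ball 0 1)) (h0 : φ 0 = 0) {z : ℂ} (hz : z ∈ ball (0 : ℂ) 1)
    (hz0 : z ≠ 0) (h : ‖φ z‖ = ‖z‖) :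
    ∃ c : ℂ, ‖c‖ = 1 ∧ c * z = φ z ∧ ∀ x ∈ ball (0 : ℂ) 1, φ x = c * x := by
  have hd : ‖dslope φ 0 z‖ = 1 / 1 := by
    rw [dslope_of_ne _ hz0, slope_def_field, h0, sub_zero, sub_zero, norm_div, h,
      div_self (norm_ne_zero_iff.2 hz0), div_one]
  have hE := Complex.affine_of_mapsTo_ball_of_norm_dslope_eq_div hφ
    (by rw [h0]; exact hm.mono_right ball_subset_closedBall) hz hd
  have hE' : ∀ x ∈ ball (0 : ℂ) 1, φ x = dslope φ 0 z * x := fun x hx => by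
    simpa [h0, mul_comm] using hE hx
  exact ⟨dslope φ 0 z, by simpa using hd, (hE' z hz).symm, hE'⟩

/-- First-order conditions at a point where the linear functional `Re (conj n * ·)` of `G` is
maximal on the closed disk through that point. -/
theorem exists_nonneg_eq_of_isMaxOn {G : ℂ → ℂ} {G' n z : ℂ} (hG : HasDerivAt G G' z)
    (hmax : ∀ x, ‖x‖ ≤ ‖z‖ → (conj n * G x).re ≤ (conj n * G z).re) :
    ∃ s : ℝ, 0 ≤ s ∧ conj n * (z * G') = s := by
  have key : ∀ (γ : ℝ → ℂ) (γ' : ℂ) (t : ℝ), γ t = z → HasDerivAt γ γ' t →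
      HasDerivAt (fun t => (conj n * G (γ t)).re) (conj n * (G' * γ')).re t := by
    intro γ γ' t ht hγ
    subst ht
    exact Complex.reCLM.hasFDerivAt.comp_hasDerivAt t ((hG.comp t hγ).const_mul (conj n))
  -- Rotating z along its circle gives a two-sided maximum, so the tangential derivative vanishes.
  have him : (conj n * (z * G')).im = 0 := by
    have h1 : HasDerivAt (fun t : ℝ => z * Complex.exp (t * Complex.I)) (z * Complex.I) 0 := by
      have h2 : HasDerivAt (fun t : ℝ => (t : ℂ) * Complex.I) Complex.I 0 := by
        simpa using (Complex.ofRealCLM.hasDerivAt (x := 0)).mul_const Complex.I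
      simpa using (h2.cexp).const_mul z
    have h3 := key _ _ 0 (by simp) h1
    have h4 : IsLocalMax (fun t : ℝ => (conj n * G (z * Complex.exp (t * Complex.I))).re) 0 :=
      Eventually.of_forall fun t => by
        simpa using hmax (z * Complex.exp (t * Complex.I)) (by simp [Complex.norm_exp_ofReal_mul_I])
    have h5 := h4.hasDerivAt_eq_zero h3
    have h6 : conj n * (G' * (z * Complex.I)) = conj n * (z * G') * Complex.I := by ring
    rw [h6, Complex.mul_I_re] at h5
    linarith
  -- Moving radially inward is allowed in one direction only, which gives a sign.
  have hre : 0 ≤ (conj n * (z * G')).re := by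
    have h1 : HasDerivAt (fun t : ℝ => ((1 - t : ℝ) : ℂ) * z) (-z) 0 := by
      have h2 : HasDerivAt (fun t : ℝ => ((1 - t : ℝ) : ℂ)) (-1) 0 := by
        simpa using (Complex.ofRealCLM.hasDerivAt (x := (0 : ℝ))).const_sub 1
      simpa using h2.mul_const z
    have h3 := key _ _ 0 (by simp) h1
    have h4 : IsLocalMaxOn (fun t : ℝ => (conj n * G (((1 - t : ℝ) : ℂ) * z)).re) (Icc 0 1) 0 := by
      filter_upwards [self_mem_nhdsWithin] with t ht
      have h5 : ‖((1 - t : ℝ) : ℂ) * z‖ ≤ ‖z‖ := by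
        rw [norm_mul, Complex.norm_real, Real.norm_of_nonneg (by linarith [ht.2])]
        nlinarith [ht.1, norm_nonneg z]
      simpa using hmax _ h5
    have h5 := h4.hasFDerivWithinAt_nonpos h3.hasFDerivAt.hasFDerivWithinAt (y := 1) (by
      have := mem_posTangentConeAt_of_segment_subset (s := Icc (0 : ℝ) 1) (x := 0) (y := 1)
        (by rw [zero_add, segment_eq_Icc zero_le_one])
      simpa using this)
    have h6 : conj n * (G' * (-z)) = - (conj n * (z * G')) := by ring
    rw [h6] at h5
    rw [ContinuousLinearMap.toSpanSingleton_apply, one_smul, Complex.neg_re] at h5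
    linarith
  exact ⟨_, hre, Complex.ext (by simp) (by simpa using him)⟩

theorem eq_zero_of_isLocalMax_re {G : ℂ → ℂ} {G' n z : ℂ} (hG : HasDerivAt G G' z)
    (hmax : IsLocalMax (fun x => (conj n * G x).re) z) : conj n * G' = 0 := by
  -- In this direction the derivative of the functional is |conj n * G'|².
  set v := conj (conj n * G') with hv
  have h1 : HasDerivAt (fun t : ℝ => z + t * v) v 0 := by
    simpa using ((Complex.ofRealCLM.hasDerivAt (x := 0)).mul_const v).const_add z
  have hG0 : HasDerivAt G G' (z + (0 : ℝ) * v) := by simpa using hG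
  have h2 : HasDerivAt (fun t : ℝ => (conj n * G (z + t * v)).re) (conj n * (G' * v)).re 0 :=
    Complex.reCLM.hasFDerivAt.comp_hasDerivAt 0 ((hG0.comp 0 h1).const_mul (conj n))
  have h3 : IsLocalMax (fun t : ℝ => (conj n * G (z + t * v)).re) 0 := by
    have h4 : Tendsto (fun t : ℝ => z + t * v) (𝓝 0) (𝓝 z) := by
      simpa using h1.continuousAt.tendsto
    simpa [IsLocalMax, IsMaxFilter] using h4.eventually hmax
  have h5 := h3.hasDerivAt_eq_zero h2
  rw [← mul_assoc, hv, Complex.mul_conj, Complex.ofReal_re] at h5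
  exact Complex.normSq_eq_zero.1 h5

/-! ### Starlikeness, support lines and injectivity of K -/

section Starlike

variable {b : ℂ} {Ω : Set ℂ} {P : ℂ → ℂ}

theorem zero_mem_unitBall : (0 : ℂ) ∈ ball (0 : ℂ) 1 := mem_ball_self one_pos

/-- The map φ = P⁻¹(b + t(P - b)) is a self-map of the disk fixing 0 and sending z to w, so the
Schwarz lemma applies. In the equality case φ(x) = cx with |c| = 1; comparing derivatives of P(cx) =
b + t(P(x) - b) at 0 gives c = t. -/
theorem norm_le_of_sub_eq_mul_sub (hΩ : StarConvex ℝ b Ω) (hP : IsConformalMapOfDiskOnto P Ω)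
    (hP0 : P 0 = b) {z w : ℂ} (hz : z ∈ ball (0 : ℂ) 1) (hw : w ∈ ball (0 : ℂ) 1) {t : ℝ}
    (ht0 : 0 ≤ t) (ht1 : t ≤ 1) (h : P w - b = t * (P z - b)) :
    ‖w‖ ≤ ‖z‖ ∧ (z ≠ 0 → ‖w‖ = ‖z‖ → t = 1) := by
  obtain ⟨hPd, hPm, hPi, hPs⟩ := hP
  have hc : IsPreconnected (ball (0 : ℂ) 1) := (convex_ball 0 1).isPreconnected
  set ψ := Function.invFunOn P (ball 0 1) with hψ
  have hψd : DifferentiableOn ℂ ψ (P '' ball 0 1) := differentiableOn_invFunOn isOpen_ball hc hPd hPi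
  have hψP : ∀ x ∈ ball (0 : ℂ) 1, ψ (P x) = x := fun x hx => hPi.leftInvOn_invFunOn hx
  have hst : ∀ x ∈ ball (0 : ℂ) 1, b + t * (P x - b) ∈ P '' ball 0 1 := fun x hx =>
    hPs (by simpa using hΩ.add_smul_sub_mem (hPm hx) ht0 ht1)
  set φ : ℂ → ℂ := fun x => ψ (b + t * (P x - b)) with hφ
  have hPφ : ∀ x ∈ ball (0 : ℂ) 1, P (φ x) = b + t * (P x - b) := fun x hx =>
    Function.invFunOn_eq (hst x hx)
  have hφm : MapsTo φ (ball 0 1) (ball 0 1) := fun x hx => Function.invFunOn_mem (hst x hx)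
  have hφd : DifferentiableOn ℂ φ (ball 0 1) :=
    hψd.comp (((hPd.sub_const b).const_mul (t : ℂ)).const_add b) hst
  have hφ0 : φ 0 = 0 := by
    have : φ 0 = ψ (P 0) := by simp [hφ, hP0]
    rw [this, hψP 0 zero_mem_unitBall]
  have hwz : φ z = w := by
    have : b + t * (P z - b) = P w := by rw [← h]; ring
    simp only [hφ, this, hψP w hw]
  refine ⟨?_, fun hz0 he => ?_⟩
  · rw [← hwz]
    exact Complex.norm_le_norm_of_mapsTo_ball hφd (hφm.mono_right ball_subset_closedBall) hφ0
      (mem_ball_zero_iff.1 hz)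
  · obtain ⟨c, hc1, -, hcx⟩ := exists_eq_mul_of_norm_eq hφd hφm hφ0 hz hz0 (by rw [hwz, he])
    have hd0 := deriv_ne_zero_of_injOn isOpen_ball hc hPd hPi zero_mem_unitBall
    have hPd0 := (hPd.differentiableAt (isOpen_ball.mem_nhds zero_mem_unitBall)).hasDerivAt
    have h1 : HasDerivAt (fun x => P (c * x)) (deriv P 0 * c) 0 := by
      have hP' : HasDerivAt P (deriv P 0) (c * 0) := by simpa using hPd0
      simpa [Function.comp_def] using hP'.comp 0 ((hasDerivAt_id (0 : ℂ)).const_mul c)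
    have h2 : HasDerivAt (fun x => P (c * x)) (t * deriv P 0) 0 := by
      refine (((hPd0.sub_const b).const_mul (t : ℂ)).const_add b).congr_of_eventuallyEq ?_
      filter_upwards [isOpen_ball.mem_nhds zero_mem_unitBall] with x hx
      rw [← hcx x hx, hPφ x hx]
    have h3 : c = t := mul_left_cancel₀ hd0 (by rw [h1.unique h2, mul_comm])
    rwa [h3, Complex.norm_real, Real.norm_of_nonneg ht0] at hc1

theorem IsConformalMapOfDiskOnto.sub_ne_zero (hP : IsConformalMapOfDiskOnto P Ω) (hP0 : P 0 = b)
    {z : ℂ} (hz : z ∈ ball (0 : ℂ) 1) (hz0 : z ≠ 0) : P z - b ≠ 0 := by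
  rw [← hP0, _root_.sub_ne_zero]
  exact fun h => hz0 (hP.2.injOn hz zero_mem_unitBall h)

theorem IsConformalMapOfDiskOnto.dslope_ne_zero (hP : IsConformalMapOfDiskOnto P Ω)
    {z : ℂ} (hz : z ∈ ball (0 : ℂ) 1) : dslope P 0 z ≠ 0 := by
  rcases eq_or_ne z 0 with rfl | hz0
  · rw [dslope_same]
    exact deriv_ne_zero_of_injOn isOpen_ball (convex_ball 0 1).isPreconnected hP.1 hP.2.injOn hz
  · intro h
    have := mul_dslope_zero P z
    rw [h, mul_zero] at this
    exact hP.sub_ne_zero rfl hz hz0 this.symm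

/-- A maximum cannot be interior because K' has no zeros. On the circle the first-order conditions
make P z - b a positive multiple τ of P w - b, and equal moduli force τ = 1. -/
theorem eq_of_isMaxOn_re (hΩ : StarConvex ℝ b Ω) (hP : IsConformalMapOfDiskOnto P Ω)
    (hP0 : P 0 = b) {z w : ℂ} (hw : w ∈ ball (0 : ℂ) 1) (hw0 : w ≠ 0) (hzw : ‖z‖ ≤ ‖w‖)
    (hmax : ∀ x, ‖x‖ ≤ ‖w‖ → (conj (P w - b) * diffQuotIntegral b P x).re ≤
      (conj (P w - b) * diffQuotIntegral b P z).re) : z = w := by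
  have hz : z ∈ ball (0 : ℂ) 1 := by
    rw [mem_ball_zero_iff] at hw ⊢
    exact hzw.trans_lt hw
  have hn : P w - b ≠ 0 := hP.sub_ne_zero hP0 hw hw0
  have hK := hasDerivAt_diffQuotIntegral hP.1 hP0 hz
  have heq : ‖z‖ = ‖w‖ := by
    refine hzw.antisymm (not_lt.1 fun hlt => ?_)
    refine mul_ne_zero ((map_ne_zero _).2 hn) (hP.dslope_ne_zero hz)
      (eq_zero_of_isLocalMax_re hK ?_)
    filter_upwards [isOpen_ball.mem_nhds (mem_ball_zero_iff.2 hlt)] with x hx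
    exact hmax x (mem_ball_zero_iff.1 hx).le
  have hz0 : z ≠ 0 := norm_ne_zero_iff.1 (heq ▸ norm_ne_zero_iff.2 hw0)
  obtain ⟨s, hs0, hs⟩ := exists_nonneg_eq_of_isMaxOn hK fun x hx => hmax x (hx.trans hzw)
  rw [mul_dslope_zero, hP0] at hs
  have hpz : P z - b ≠ 0 := hP.sub_ne_zero hP0 hz hz0
  have hN : 0 < Complex.normSq (P w - b) := Complex.normSq_pos.2 hn
  have hs' : s ≠ 0 := by
    rintro rfl
    rw [Complex.ofReal_zero] at hs
    exact mul_ne_zero ((map_ne_zero _).2 hn) hpz hs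
  set τ : ℝ := s / Complex.normSq (P w - b) with hτ
  have hτ0 : 0 < τ := div_pos (hs0.lt_of_ne' hs') hN
  have hzw' : P z - b = τ * (P w - b) := by
    have h1 : (Complex.normSq (P w - b) : ℂ) * (P z - b) = s * (P w - b) := by
      rw [← Complex.mul_conj, ← hs]; ring
    have h2 : (Complex.normSq (P w - b) : ℂ) ≠ 0 := by exact_mod_cast hN.ne'
    rw [hτ, Complex.ofReal_div, div_mul_eq_mul_div, ← h1, mul_div_cancel_left₀ _ h2]
  have hτ1 : τ = 1 := by
    -- Whichever of P z and P w is nearer to b is the contraction of the other.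
    rcases le_total τ 1 with h1 | h1
    · exact (norm_le_of_sub_eq_mul_sub hΩ hP hP0 hw hz hτ0.le h1 hzw').2 hw0 heq
    · have h2 : P w - b = (τ⁻¹ : ℝ) * (P z - b) := by
        have : (τ : ℂ) ≠ 0 := by exact_mod_cast hτ0.ne'
        rw [hzw', Complex.ofReal_inv, inv_mul_cancel_left₀ this]
      have h3 := (norm_le_of_sub_eq_mul_sub hΩ hP hP0 hz hw (inv_nonneg.2 hτ0.le)
        (inv_le_one_of_one_le₀ h1) h2).2 hz0 heq.symm
      simpa using h3
  refine hP.2.injOn hz hw ?_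
  simpa [hτ1] using hzw'

theorem continuousOn_diffQuotIntegral {g : ℂ → ℂ} (hg : DifferentiableOn ℂ g (ball 0 1))
    (hg0 : g 0 = b) : ContinuousOn (diffQuotIntegral b g) (ball 0 1) := fun _ hz =>
  (hasDerivAt_diffQuotIntegral hg hg0 hz).continuousAt.continuousWithinAt

/-- `P w - b` is an outer normal at the boundary point `diffQuotIntegral b P w` of the image of the
disk of radius `‖w‖`, and that image touches its supporting line only there. -/
theorem re_le_and_eq_of_re_eq (hΩ : StarConvex ℝ b Ω) (hP : IsConformalMapOfDiskOnto P Ω)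
    (hP0 : P 0 = b) {z w : ℂ} (hw : w ∈ ball (0 : ℂ) 1) (hw0 : w ≠ 0) (hzw : ‖z‖ ≤ ‖w‖) :
    (conj (P w - b) * diffQuotIntegral b P z).re ≤ (conj (P w - b) * diffQuotIntegral b P w).re ∧
    ((conj (P w - b) * diffQuotIntegral b P z).re = (conj (P w - b) * diffQuotIntegral b P w).re →
      z = w) := by
  have hcont : ContinuousOn (fun x => (conj (P w - b) * diffQuotIntegral b P x).re)
      (closedBall 0 ‖w‖) :=
    Complex.continuous_re.comp_continuousOn (continuousOn_const.mul
      ((continuousOn_diffQuotIntegral hP.1 hP0).mono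
        (closedBall_subset_ball (mem_ball_zero_iff.1 hw))))
  obtain ⟨m, hm, hmax⟩ := (isCompact_closedBall (0 : ℂ) ‖w‖).exists_isMaxOn
    ⟨0, by simp⟩ hcont
  have hmax' : ∀ x, ‖x‖ ≤ ‖w‖ → (conj (P w - b) * diffQuotIntegral b P x).re ≤
      (conj (P w - b) * diffQuotIntegral b P m).re := fun x hx =>
    hmax (mem_closedBall_zero_iff.2 hx)
  obtain rfl := eq_of_isMaxOn_re hΩ hP hP0 hw hw0 (mem_closedBall_zero_iff.1 hm) hmax'
  refine ⟨hmax' z hzw, fun h => eq_of_isMaxOn_re hΩ hP hP0 hw hw0 hzw ?_⟩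
  rw [h]
  exact hmax'

theorem injOn_diffQuotIntegral (hΩ : StarConvex ℝ b Ω) (hP : IsConformalMapOfDiskOnto P Ω)
    (hP0 : P 0 = b) : InjOn (diffQuotIntegral b P) (ball 0 1) := by
  have key : ∀ z ∈ ball (0 : ℂ) 1, ∀ w ∈ ball (0 : ℂ) 1, ‖z‖ ≤ ‖w‖ →
      diffQuotIntegral b P z = diffQuotIntegral b P w → z = w := by
    intro z hz w hw hzw h
    rcases eq_or_ne w 0 with rfl | hw0
    · simpa using hzw
    · exact (re_le_and_eq_of_re_eq hΩ hP hP0 hw hw0 hzw).2 (by rw [h])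
  intro z hz w hw h
  rcases le_total ‖z‖ ‖w‖ with h1 | h1
  · exact key z hz w hw h1 h
  · exact (key w hw z hz h1 h.symm).symm

end Starlike

/-! ### Subordination of G to K -/

section Subordination

variable {b : ℂ} {Ω : Set ℂ} {P g : ℂ → ℂ}

/-- The subordination principle. -/
theorem exists_eq_of_mem_analyticInto (hP : IsConformalMapOfDiskOnto P Ω)
    (hP0 : P 0 = b) (hg : g ∈ analyticInto Ω) (hg0 : g 0 = b) {z : ℂ} (hz : z ∈ ball (0 : ℂ) 1) :
    ∃ x ∈ ball (0 : ℂ) 1, ‖x‖ ≤ ‖z‖ ∧ P x = g z := by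
  obtain ⟨hPd, -, hPi, hPs⟩ := hP
  have hgm : MapsTo g (ball 0 1) (P '' ball 0 1) := fun x hx => hPs (hg.2 hx)
  have hψ := differentiableOn_invFunOn isOpen_ball (convex_ball (0 : ℂ) 1).isPreconnected hPd hPi
  have hm : MapsTo (Function.invFunOn P (ball 0 1) ∘ g) (ball 0 1) (ball 0 1) :=
    fun x hx => Function.invFunOn_mem (hgm hx)
  refine ⟨Function.invFunOn P (ball 0 1) (g z), hm hz, ?_, Function.invFunOn_eq (hgm hz)⟩
  refine Complex.norm_le_norm_of_mapsTo_ball (hψ.comp hg.1 hgm)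
    (hm.mono_right ball_subset_closedBall) ?_ (mem_ball_zero_iff.1 hz)
  rw [Function.comp_apply, hg0, ← hP0]
  exact hPi.leftInvOn_invFunOn zero_mem_unitBall

/-- Jack's lemma applied to the local subordination of `diffQuotIntegral b g` to
`diffQuotIntegral b P`. -/
theorem norm_invFunOn_le (hΩ : StarConvex ℝ b Ω) (hP : IsConformalMapOfDiskOnto P Ω)
    (hP0 : P 0 = b) (hg : g ∈ analyticInto Ω) (hg0 : g 0 = b) {s : ℝ} (hs1 : s ≤ 1)
    (hm : MapsTo (diffQuotIntegral b g) (ball 0 s) (diffQuotIntegral b P '' ball 0 1))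
    {z : ℂ} (hz : z ∈ ball (0 : ℂ) s) :
    ‖Function.invFunOn (diffQuotIntegral b P) (ball 0 1) (diffQuotIntegral b g z)‖ ≤ ‖z‖ := by
  set K := diffQuotIntegral b P with hK
  set G := diffQuotIntegral b g with hG
  set ψ := Function.invFunOn K (ball 0 1) with hψ
  have hs0 : 0 < s := pos_of_mem_ball hz
  have hKd : ∀ x ∈ ball (0 : ℂ) 1, HasDerivAt K (dslope P 0 x) x := fun x hx =>
    hasDerivAt_diffQuotIntegral hP.1 hP0 hx
  have hGd : ∀ x ∈ ball (0 : ℂ) s, HasDerivAt G (dslope g 0 x) x := fun x hx =>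
    hasDerivAt_diffQuotIntegral hg.1 hg0 (ball_subset_ball hs1 hx)
  have hKi : InjOn K (ball 0 1) := injOn_diffQuotIntegral hΩ hP hP0
  have hψd : DifferentiableOn ℂ ψ (K '' ball 0 1) :=
    differentiableOn_invFunOn isOpen_ball (convex_ball (0 : ℂ) 1).isPreconnected
      (fun x hx => (hKd x hx).differentiableAt.differentiableWithinAt) hKi
  set ω := ψ ∘ G with hω
  have hωm : ∀ x ∈ ball (0 : ℂ) s, ω x ∈ ball (0 : ℂ) 1 := fun x hx =>
    Function.invFunOn_mem (hm hx)
  have hKω : ∀ x ∈ ball (0 : ℂ) s, K (ω x) = G x := fun x hx => Function.invFunOn_eq (hm hx)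
  have hωd : DifferentiableOn ℂ ω (ball 0 s) :=
    hψd.comp (fun x hx => (hGd x hx).differentiableAt.differentiableWithinAt) hm
  have hω0 : ω 0 = 0 := by
    have h1 : ω 0 = ψ (K 0) := by
      simp only [hω, Function.comp_apply, hK, hG, diffQuotIntegral_zero]
    rw [h1]
    exact hKi.leftInvOn_invFunOn zero_mem_unitBall
  change ‖ω z‖ ≤ ‖z‖
  rcases eq_or_ne z 0 with rfl | hz0
  · simp [hω0]
  set q := dslope ω 0 with hq
  have hωq : ∀ x, x * q x = ω x := fun x => by rw [hq, mul_dslope_zero, hω0, sub_zero]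
  have hqd : DifferentiableOn ℂ q (ball 0 s) :=
    (Complex.differentiableOn_dslope (ball_mem_nhds 0 hs0)).2 hωd
  have hr0 : 0 < ‖z‖ := norm_pos_iff.2 hz0
  have hrs : closedBall (0 : ℂ) ‖z‖ ⊆ ball 0 s := closedBall_subset_ball (mem_ball_zero_iff.1 hz)
  obtain ⟨z₁, hz₁, hmax⟩ := Complex.exists_mem_frontier_isMaxOn_norm
    (isBounded_ball (x := (0 : ℂ)) (r := ‖z‖)) ⟨0, mem_ball_self hr0⟩
    (hqd.mono (closure_ball_subset_closedBall.trans hrs)).diffContOnCl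
  rw [frontier_ball _ hr0.ne', mem_sphere_zero_iff_norm] at hz₁
  rw [closure_ball _ hr0.ne'] at hmax
  have hmax' : ∀ x, ‖x‖ ≤ ‖z‖ → ‖q x‖ ≤ ‖q z₁‖ := fun x hx =>
    hmax (mem_closedBall_zero_iff.2 hx)
  suffices h : ‖q z₁‖ ≤ 1 by
    rw [← hωq z, norm_mul]
    exact mul_le_of_le_one_right hr0.le ((hmax' z le_rfl).trans h)
  rcases eq_or_ne (q z₁) 0 with hq0 | hq0
  · simp [hq0]
  have hz₁s : z₁ ∈ ball (0 : ℂ) s := hrs (mem_closedBall_zero_iff.2 hz₁.le)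
  have hqz₁ := (hqd.differentiableAt (isOpen_ball.mem_nhds hz₁s)).hasDerivAt
  -- With n = q z₁, maximality of |q| at z₁ becomes maximality of the linear functional Re(conj n *
  -- q).
  obtain ⟨σ, hσ0, hσ⟩ := exists_nonneg_eq_of_isMaxOn (n := q z₁) hqz₁ fun x hx => by
    calc (conj (q z₁) * q x).re ≤ ‖conj (q z₁) * q x‖ := Complex.re_le_norm _
      _ = ‖q z₁‖ * ‖q x‖ := by rw [norm_mul, Complex.norm_conj]
      _ ≤ ‖q z₁‖ * ‖q z₁‖ := by gcongr; exact hmax' x (hx.trans hz₁.le)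
      _ = (conj (q z₁) * q z₁).re := by
        rw [← Complex.normSq_eq_conj_mul_self, Complex.ofReal_re, Complex.normSq_eq_norm_sq, sq]
  have hω' : HasDerivAt ω (q z₁ + z₁ * deriv q z₁) z₁ := by
    have h1 := (hasDerivAt_id z₁).mul hqz₁
    have h2 : (id * q) = ω := funext hωq
    simpa [h2] using h1
  have hcomp : dslope P 0 (ω z₁) * (q z₁ + z₁ * deriv q z₁) = dslope g 0 z₁ := by
    refine ((hKd _ (hωm _ hz₁s)).comp z₁ hω').unique ((hGd _ hz₁s).congr_of_eventuallyEq ?_)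
    filter_upwards [isOpen_ball.mem_nhds hz₁s] with x hx using hKω x hx
  have hN : 0 < Complex.normSq (q z₁) := Complex.normSq_pos.2 hq0
  have hN' : (Complex.normSq (q z₁) : ℂ) ≠ 0 := by exact_mod_cast hN.ne'
  -- This is the multiplier of Jack's lemma: z₁ ω'(z₁) = m ω(z₁).
  set m : ℝ := 1 + σ / Complex.normSq (q z₁) with hmdef
  have hm1 : 1 ≤ m := le_add_of_nonneg_right (div_nonneg hσ0 hN.le)
  have hmq : q z₁ + z₁ * deriv q z₁ = m * q z₁ := by
    have h1 : (Complex.normSq (q z₁) : ℂ) * (z₁ * deriv q z₁) = σ * q z₁ := by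
      rw [← Complex.mul_conj, ← hσ]; ring
    have h2 : z₁ * deriv q z₁ = σ / Complex.normSq (q z₁) * q z₁ := by
      rw [div_mul_eq_mul_div, ← h1, mul_div_cancel_left₀ _ hN']
    rw [h2, hmdef]; push_cast; ring
  obtain ⟨x, hx, hxz, hPx⟩ := exists_eq_of_mem_analyticInto hP hP0 hg hg0
    (ball_subset_ball hs1 hz₁s)
  have hm0 : (m : ℂ) ≠ 0 := by exact_mod_cast (one_pos.trans_le hm1).ne'
  have hPω : P (ω z₁) - b = (m⁻¹ : ℝ) * (P x - b) := by
    have h1 : P x - b = m * (P (ω z₁) - b) := by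
      have h3 := mul_dslope_zero P (ω z₁)
      have h4 := mul_dslope_zero g z₁
      rw [hP0] at h3
      rw [hg0, ← hcomp, hmq] at h4
      rw [hPx, ← h3, ← h4, ← hωq z₁]
      ring
    rw [h1, Complex.ofReal_inv, inv_mul_cancel_left₀ hm0]
  have h5 := (norm_le_of_sub_eq_mul_sub hΩ hP hP0 hx (hωm _ hz₁s)
    (inv_nonneg.2 (zero_le_one.trans hm1)) (inv_le_one_of_one_le₀ hm1) hPω).1.trans hxz
  rw [← hωq z₁, norm_mul] at h5
  exact le_of_mul_le_mul_left (by simpa using h5) (hz₁ ▸ hr0)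

theorem isOpen_image_diffQuotIntegral (hΩ : StarConvex ℝ b Ω) (hP : IsConformalMapOfDiskOnto P Ω)
    (hP0 : P 0 = b) {s : Set ℂ} (hs : s ⊆ ball 0 1) (hso : IsOpen s) :
    IsOpen (diffQuotIntegral b P '' s) :=
  isOpen_image_of_injOn isOpen_ball (convex_ball (0 : ℂ) 1).isPreconnected
    (fun _ hx => (hasDerivAt_diffQuotIntegral hP.1 hP0 hx).differentiableAt.differentiableWithinAt)
    (injOn_diffQuotIntegral hΩ hP hP0) hs hso

theorem isCompact_image_diffQuotIntegral (hP : IsConformalMapOfDiskOnto P Ω)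
    (hP0 : P 0 = b) {r : ℝ} (hr : r < 1) :
    IsCompact (diffQuotIntegral b P '' closedBall 0 r) :=
  (isCompact_closedBall 0 r).image_of_continuousOn
    ((continuousOn_diffQuotIntegral hP.1 hP0).mono (closedBall_subset_ball hr))

/-- Let s be the supremum of the radii on which G stays in K(𝔻). If s < 1, the bound |ω(z)| ≤ |z|
keeps G on |z| ≤ s inside the compact set K(|z| ≤ s); openness of K(𝔻) then allows a larger radius.
-/
theorem mapsTo_diffQuotIntegral (hΩ : StarConvex ℝ b Ω) (hP : IsConformalMapOfDiskOnto P Ω)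
    (hP0 : P 0 = b) (hg : g ∈ analyticInto Ω) (hg0 : g 0 = b) :
    MapsTo (diffQuotIntegral b g) (ball 0 1) (diffQuotIntegral b P '' ball 0 1) := by
  set K := diffQuotIntegral b P with hK
  set G := diffQuotIntegral b g with hG
  set T : Set ℝ := {s | 0 ≤ s ∧ s ≤ 1 ∧ MapsTo G (ball 0 s) (K '' ball 0 1)} with hT
  have hT0 : (0 : ℝ) ∈ T := ⟨le_rfl, zero_le_one, by simp [MapsTo]⟩
  have hTb : BddAbove T := ⟨1, fun s hs => hs.2.1⟩
  set s := sSup T with hs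
  have hs0 : 0 ≤ s := le_csSup hTb hT0
  have hs1 : s ≤ 1 := csSup_le ⟨0, hT0⟩ fun s hs => hs.2.1
  have hsm : MapsTo G (ball 0 s) (K '' ball 0 1) := by
    intro z hz
    obtain ⟨t, ht, hzt⟩ := exists_lt_of_lt_csSup ⟨0, hT0⟩ (mem_ball_zero_iff.1 hz)
    exact ht.2.2 (mem_ball_zero_iff.2 hzt)
  rcases hs1.eq_or_lt with h1 | h1
  · rwa [h1] at hsm
  exfalso
  have hGc : ContinuousOn G (ball 0 1) := continuousOn_diffQuotIntegral hg.1 hg0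
  have hsc : MapsTo G (closedBall 0 s) (K '' closedBall 0 s) := by
    rcases hs0.eq_or_lt with h0 | h0
    · rw [← h0, closedBall_zero]
      rintro _ rfl
      exact ⟨0, rfl, by rw [hK, hG, diffQuotIntegral_zero, diffQuotIntegral_zero]⟩
    · have h2 : MapsTo G (ball 0 s) (K '' closedBall 0 s) := fun z hz =>
        ⟨_, mem_closedBall_zero_iff.2
          ((norm_invFunOn_le hΩ hP hP0 hg hg0 hs1 hsm hz).trans (mem_ball_zero_iff.1 hz).le),
          Function.invFunOn_eq (hsm hz)⟩
      have h3 := h2.closure_of_continuousOn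
        (hGc.mono (closure_ball_subset_closedBall.trans (closedBall_subset_ball h1)))
      rwa [closure_ball _ h0.ne',
        (isCompact_image_diffQuotIntegral hP hP0 h1).isClosed.closure_eq] at h3
  have hopen : IsOpen (ball 0 1 ∩ G ⁻¹' (K '' ball 0 1)) :=
    hGc.isOpen_inter_preimage isOpen_ball
      (isOpen_image_diffQuotIntegral hΩ hP hP0 Subset.rfl isOpen_ball)
  obtain ⟨δ, hδ, hsub⟩ := (isCompact_closedBall (0 : ℂ) s).exists_thickening_subset_open hopen
    fun z hz => ⟨closedBall_subset_ball h1 hz, image_mono (closedBall_subset_ball h1) (hsc hz)⟩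
  rw [thickening_closedBall hδ hs0] at hsub
  have hmem : min 1 (δ + s) ∈ T :=
    ⟨le_min zero_le_one (by positivity), min_le_left _ _,
      fun z hz => (hsub (ball_subset_ball (min_le_right _ _) hz)).2⟩
  exact (le_csSup hTb hmem).not_gt (lt_min h1 (by linarith))

end Subordination

/-! ### Geometry of the region and extremal functions -/

section Region

variable {b : ℂ} {Ω : Set ℂ} {P g : ℂ → ℂ}

/-- The images of disks under `diffQuotIntegral b P` are convex (Alexander's theorem). -/
theorem convex_image_diffQuotIntegral (hΩ : StarConvex ℝ b Ω) (hP : IsConformalMapOfDiskOnto P Ω)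
    (hP0 : P 0 = b) {r : ℝ} (hr0 : 0 < r) (hr1 : r < 1) :
    Convex ℝ (diffQuotIntegral b P '' closedBall 0 r) := by
  set K := diffQuotIntegral b P with hK
  have hK0 : K 0 = 0 := diffQuotIntegral_zero b P
  have hmem : ∀ w : ℂ, ‖w‖ = r → w ∈ ball (0 : ℂ) 1 := fun w hw =>
    mem_ball_zero_iff.2 (hw.trans_lt hr1)
  have hne : ∀ w : ℂ, ‖w‖ = r → w ≠ 0 := fun w hw => norm_pos_iff.1 (hw ▸ hr0)
  -- The image is the intersection of its supporting half-planes.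
  have hEq : K '' closedBall 0 r =
      ⋂ w ∈ sphere (0 : ℂ) r, {u | (conj (P w - b) * u).re ≤ (conj (P w - b) * K w).re} := by
    refine Subset.antisymm ?_ fun x hx => ?_
    · rintro _ ⟨z, hz, rfl⟩
      refine mem_iInter₂.2 fun w hw => ?_
      rw [mem_sphere_zero_iff_norm] at hw
      rw [mem_closedBall_zero_iff, ← hw] at hz
      exact (re_le_and_eq_of_re_eq hΩ hP hP0 (hmem w hw) (hne w hw) hz).1
    · by_contra hxK
      have hcomp := isCompact_image_diffQuotIntegral hP hP0 hr1
      -- For x outside the image, follow the segment from K 0 = 0 towards x to its last point t x in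
      -- the image. That point is K w with |w| = r, and the support line at K w separates x from the
      -- image.
      set A : Set ℝ := Icc 0 1 ∩ (fun t : ℝ => (t : ℂ) * x) ⁻¹' (K '' closedBall 0 r) with hA
      have hcont : Continuous fun t : ℝ => (t : ℂ) * x := by fun_prop
      have hAc : IsCompact A := isCompact_Icc.inter_right (hcomp.isClosed.preimage hcont)
      have hA0 : (0 : ℝ) ∈ A :=
        ⟨by simp, ⟨0, by simp [hr0.le], by simp [hK0]⟩⟩
      obtain ⟨t, htA, htmax⟩ := hAc.exists_isGreatest ⟨0, hA0⟩
      obtain ⟨⟨ht0, ht1⟩, w, hw, hwt⟩ := htA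
      have ht1' : t < 1 := lt_of_le_of_ne ht1 (by
        rintro rfl
        exact hxK ⟨w, hw, by simpa using hwt⟩)
      have hgt : ∀ z ∈ ball (0 : ℂ) r, K z ≠ t * x := by
        intro z hz hzt
        have hopen := (isOpen_image_diffQuotIntegral hΩ hP hP0 (ball_subset_ball hr1.le)
          isOpen_ball).preimage hcont
        have h1 : ∀ᶠ s in 𝓝[>] t, s ∈ (fun t : ℝ => (t : ℂ) * x) ⁻¹' (K '' ball 0 r) ∧ s < 1 :=
          nhdsWithin_le_nhds (inter_mem (hopen.mem_nhds ⟨z, hz, hzt⟩) (Iio_mem_nhds ht1'))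
        obtain ⟨s, ⟨hsK, hs1⟩, hts⟩ := (h1.and self_mem_nhdsWithin).exists
        exact (htmax ⟨⟨ht0.trans (le_of_lt hts), hs1.le⟩,
          image_mono ball_subset_closedBall hsK⟩).not_gt hts
      have hwr : ‖w‖ = r := by
        refine (mem_closedBall_zero_iff.1 hw).antisymm (not_lt.1 fun h => ?_)
        exact hgt w (mem_ball_zero_iff.2 h) hwt
      have h1 := mem_iInter₂.1 hx w (mem_sphere_zero_iff_norm.2 hwr)
      have h2 := re_le_and_eq_of_re_eq hΩ hP hP0 (z := 0) (hmem w hwr) (hne w hwr) (by simp)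
      have h3 : (conj (P w - b) * K 0).re < (conj (P w - b) * K w).re :=
        lt_of_le_of_ne h2.1 fun h => hne w hwr (h2.2 h).symm
      have h4 : (conj (P w - b) * K w).re = t * (conj (P w - b) * x).re := by
        rw [hwt, mul_left_comm, Complex.re_ofReal_mul]
      simp only [mem_ofPred_eq] at h1
      rw [hK0, mul_zero, Complex.zero_re, h4] at h3
      rw [h4] at h1
      -- The value ρ of the functional at x satisfies ρ > 0 and ρ ≤ tρ, contradicting t < 1.
      nlinarith [pos_of_mul_pos_right h3 ht0]
  rw [hEq]
  refine convex_iInter₂ fun w _ => convex_halfSpace_le ⟨fun x y => ?_, fun c x => ?_⟩ _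
  · rw [mul_add, Complex.add_re]
  · rw [Complex.real_smul, mul_left_comm, Complex.re_ofReal_mul, smul_eq_mul]

theorem isClosedJordanDomain_image_diffQuotIntegral (hΩ : StarConvex ℝ b Ω)
    (hP : IsConformalMapOfDiskOnto P Ω) (hP0 : P 0 = b) {r : ℝ} (hr0 : 0 < r) (hr1 : r < 1) :
    IsClosedJordanDomain (diffQuotIntegral b P '' closedBall 0 r) := by
  set K := diffQuotIntegral b P with hK
  have hcont : ContinuousOn K (ball 0 1) := continuousOn_diffQuotIntegral hP.1 hP0
  have hinj : InjOn K (ball 0 1) := injOn_diffQuotIntegral hΩ hP hP0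
  have hcomp := isCompact_image_diffQuotIntegral hP hP0 hr1
  have hcl1 : closedBall (0 : ℂ) r ⊆ ball 0 1 := closedBall_subset_ball hr1
  have hopen : IsOpen (K '' ball 0 r) :=
    isOpen_image_diffQuotIntegral hΩ hP hP0 (ball_subset_ball hr1.le) isOpen_ball
  have hclosure : K '' closedBall 0 r = closure (K '' ball 0 r) := by
    refine Subset.antisymm ?_
      (closure_minimal (image_mono ball_subset_closedBall) hcomp.isClosed)
    rw [← closure_ball (0 : ℂ) hr0.ne']
    exact (hcont.mono (closure_ball_subset_closedBall.trans hcl1)).image_closure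
  refine ⟨K '' ball 0 r, ⟨hopen, ?_, hcomp.isBounded.subset (image_mono ball_subset_closedBall),
    ?_⟩, hclosure⟩
  · exact ((convex_ball (0 : ℂ) r).isConnected ⟨0, mem_ball_self hr0⟩).image K
      (hcont.mono (ball_subset_ball hr1.le))
  · have hcirc : ∀ c : Circle, (r : ℂ) * c ∈ ball (0 : ℂ) 1 := fun c => by
      simpa [abs_of_pos hr0, Circle.norm_coe] using hr1
    refine ⟨fun c => K (r * c), hcont.comp_continuous (by fun_prop) hcirc, fun c d h => ?_, ?_⟩
    · have hr : (r : ℂ) ≠ 0 := by exact_mod_cast hr0.ne'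
      exact Circle.ext (mul_left_cancel₀ hr (hinj (hcirc c) (hcirc d) h))
    -- By injectivity, removing K of the open disk from K of the closed disk leaves exactly K of the
    -- circle.
    · rw [hopen.frontier_eq, ← hclosure, ← (hinj.mono hcl1).image_sdiff_subset ball_subset_closedBall,
        closedBall_sdiff_ball]
      ext u
      constructor
      · rintro ⟨c, rfl⟩
        exact ⟨r * c, by simp [abs_of_pos hr0, Circle.norm_coe], rfl⟩
      · rintro ⟨z, hz, rfl⟩
        rw [mem_sphere_zero_iff_norm] at hz
        have hr : (r : ℂ) ≠ 0 := by exact_mod_cast hr0.ne'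
        refine ⟨⟨z / r, ?_⟩, ?_⟩
        · refine mem_sphere_zero_iff_norm.2 ?_
          rw [norm_div, hz, Complex.norm_real, Real.norm_of_nonneg hr0.le, div_self hr0.ne']
        · simp only [mul_div_cancel₀ _ hr]

theorem comp_mul_mem_analyticInto (hg : g ∈ analyticInto Ω) {c : ℂ} (hc : ‖c‖ ≤ 1) :
    (fun z => g (c * z)) ∈ analyticInto Ω := by
  have hm : MapsTo (fun z => c * z) (ball (0 : ℂ) 1) (ball 0 1) := fun z hz => by
    rw [mem_ball_zero_iff] at hz ⊢
    rw [norm_mul]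
    nlinarith [norm_nonneg z]
  exact ⟨hg.1.comp (by fun_prop) hm, hg.2.comp hm⟩

theorem IsConformalMapOfDiskOnto.mem_analyticInto (hP : IsConformalMapOfDiskOnto P Ω) :
    P ∈ analyticInto Ω :=
  ⟨hP.1, hP.2.mapsTo⟩

theorem variabilityRegion_eq_image (hΩ : StarConvex ℝ b Ω) (hP : IsConformalMapOfDiskOnto P Ω)
    (hP0 : P 0 = b) {z₀ : ℂ} (hz₀ : z₀ ∈ ball (0 : ℂ) 1) (hz₀_ne : z₀ ≠ 0) :
    variabilityRegion Ω b z₀ = diffQuotIntegral b P '' closedBall 0 ‖z₀‖ := by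
  refine Subset.antisymm ?_ ?_
  · rintro _ ⟨g, hg, hg0, rfl⟩
    have hm := mapsTo_diffQuotIntegral hΩ hP hP0 hg hg0
    exact ⟨_, mem_closedBall_zero_iff.2 (norm_invFunOn_le hΩ hP hP0 hg hg0 le_rfl hm hz₀),
      Function.invFunOn_eq (hm hz₀)⟩
  · rintro _ ⟨w, hw, rfl⟩
    have hc : ‖w / z₀‖ ≤ 1 := by
      rw [norm_div]
      exact div_le_one_of_le₀ (mem_closedBall_zero_iff.1 hw) (norm_nonneg _)
    refine ⟨fun z => P (w / z₀ * z), comp_mul_mem_analyticInto hP.mem_analyticInto hc, by simpa, ?_⟩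
    rw [diffQuotIntegral_comp_mul hP0, div_mul_cancel₀ _ hz₀_ne]

/-- The integral determines g through z G'(z) = g(z) - b. -/
theorem eqOn_of_eqOn_diffQuotIntegral {h : ℂ → ℂ} (hg : DifferentiableOn ℂ g (ball 0 1))
    (hg0 : g 0 = b) (hh : DifferentiableOn ℂ h (ball 0 1)) (hh0 : h 0 = b)
    (heq : EqOn (diffQuotIntegral b g) (diffQuotIntegral b h) (ball 0 1)) :
    EqOn g h (ball 0 1) := by
  intro x hx
  have h1 : dslope g 0 x = dslope h 0 x :=
    (hasDerivAt_diffQuotIntegral hg hg0 hx).unique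
      ((hasDerivAt_diffQuotIntegral hh hh0 hx).congr_of_eventuallyEq
        (heq.eventuallyEq_of_mem (isOpen_ball.mem_nhds hx)))
  have h2 := mul_dslope_zero g x
  rw [h1, mul_dslope_zero, hg0, hh0] at h2
  exact (sub_left_inj.1 h2).symm

theorem diffQuotIntegral_congr {h : ℂ → ℂ} (heq : EqOn g h (ball 0 1)) {z : ℂ}
    (hz : z ∈ ball (0 : ℂ) 1) : diffQuotIntegral b g z = diffQuotIntegral b h z := by
  refine intervalIntegral.integral_congr fun t ht => ?_
  rw [uIcc_of_le zero_le_one] at ht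
  have : (t : ℂ) * z ∈ ball (0 : ℂ) 1 := by
    rw [mem_ball_zero_iff] at hz ⊢
    rw [norm_mul, Complex.norm_real, Real.norm_of_nonneg ht.1]
    nlinarith [ht.1, ht.2, norm_nonneg z]
  simp only [heq this]

theorem diffQuotIntegral_eq_iff (hΩ : StarConvex ℝ b Ω) (hP : IsConformalMapOfDiskOnto P Ω)
    (hP0 : P 0 = b) {z₀ : ℂ} (hz₀ : z₀ ∈ ball (0 : ℂ) 1) (hz₀_ne : z₀ ≠ 0) {ε : ℂ} (hε : ‖ε‖ = 1)
    (hg : g ∈ analyticInto Ω) (hg0 : g 0 = b) :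
    diffQuotIntegral b g z₀ = diffQuotIntegral b P (ε * z₀) ↔
      EqOn g (fun z => P (ε * z)) (ball 0 1) := by
  constructor
  · intro h
    have hm := mapsTo_diffQuotIntegral hΩ hP hP0 hg hg0
    have hinj := injOn_diffQuotIntegral hΩ hP hP0
    have hKd : DifferentiableOn ℂ (diffQuotIntegral b P) (ball 0 1) := fun x hx =>
      (hasDerivAt_diffQuotIntegral hP.1 hP0 hx).differentiableAt.differentiableWithinAt
    have hGd : DifferentiableOn ℂ (diffQuotIntegral b g) (ball 0 1) := fun x hx =>
      (hasDerivAt_diffQuotIntegral hg.1 hg0 hx).differentiableAt.differentiableWithinAt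
    have hω0 := norm_invFunOn_le hΩ hP hP0 hg hg0 le_rfl hm zero_mem_unitBall
    have hεz : ε * z₀ ∈ ball (0 : ℂ) 1 := by
      rwa [mem_ball_zero_iff, norm_mul, hε, one_mul, ← mem_ball_zero_iff]
    have hωz₀ : Function.invFunOn (diffQuotIntegral b P) (ball 0 1) (diffQuotIntegral b g z₀)
        = ε * z₀ := by
      rw [h]
      exact hinj.leftInvOn_invFunOn hεz
    -- Here ω(z₀) = εz₀ is the equality case of the Schwarz lemma, so ω is a rotation.
    obtain ⟨c, -, hcz, hcx⟩ := exists_eq_mul_of_norm_eq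
      (φ := Function.invFunOn (diffQuotIntegral b P) (ball 0 1) ∘ diffQuotIntegral b g)
      ((differentiableOn_invFunOn isOpen_ball (convex_ball (0 : ℂ) 1).isPreconnected hKd
        hinj).comp hGd hm) (fun x hx => Function.invFunOn_mem (hm hx))
      (norm_le_zero_iff.1 (by simpa using hω0)) hz₀ hz₀_ne
      (by rw [Function.comp_apply, hωz₀, norm_mul, hε, one_mul])
    obtain rfl : c = ε := mul_right_cancel₀ hz₀_ne (hcz.trans hωz₀)
    refine eqOn_of_eqOn_diffQuotIntegral hg.1 hg0
      (comp_mul_mem_analyticInto hP.mem_analyticInto hε.le).1 (by simpa) fun x hx => ?_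
    rw [diffQuotIntegral_comp_mul hP0, ← hcx x hx]
    exact (Function.invFunOn_eq (hm hx)).symm
  · intro h
    rw [diffQuotIntegral_congr h hz₀, diffQuotIntegral_comp_mul hP0]

end Region

theorem mainTheorem1 (b z₀ : ℂ) (hz₀ : z₀ ∈ Metric.ball (0 : ℂ) 1) (hz₀_ne : z₀ ≠ 0)
    (Ω : Set ℂ) (hΩ_open : IsOpen Ω) (hΩ_star : StarConvex ℝ b Ω) (hΩ_ne : Ω ≠ Set.univ)
    (P : ℂ → ℂ) (hP : IsConformalMapOfDiskOnto P Ω) (hP0 : P 0 = b) :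
    Convex ℝ (variabilityRegion Ω b z₀) ∧
    IsClosedJordanDomain (variabilityRegion Ω b z₀) ∧
    variabilityRegion Ω b z₀ = diffQuotIntegral b P '' Metric.closedBall (0 : ℂ) ‖z₀‖ ∧
    ∀ ε : ℂ, ‖ε‖ = 1 → ∀ g ∈ analyticInto Ω, g 0 = b →
      (diffQuotIntegral b g z₀ = diffQuotIntegral b P (ε * z₀) ↔
        Set.EqOn g (fun z => P (ε * z)) (Metric.ball (0 : ℂ) 1)) := by
  have hr0 : 0 < ‖z₀‖ := norm_pos_iff.2 hz₀_ne
  have hr1 : ‖z₀‖ < 1 := mem_ball_zero_iff.1 hz₀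
  have hV := variabilityRegion_eq_image hΩ_star hP hP0 hz₀ hz₀_ne
  refine ⟨?_, ?_, hV, fun ε hε g hg hg0 =>
    diffQuotIntegral_eq_iff hΩ_star hP hP0 hz₀ hz₀_ne hε hg hg0⟩
  · rw [hV]
    exact convex_image_diffQuotIntegral hΩ_star hP hP0 hr0 hr1
  · rw [hV]
    exact isClosedJordanDomain_image_diffQuotIntegral hΩ_star hP hP0 hr0 hr1
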